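/- There is an absolute constant $C>0$ such that the following holds for every integer $s\ge 1$. Let $G=(V,E)$ be a finite connected graph that does not contain the complete bipartite graph $K_{s,s}$ as a minor, let $w:E\to(0,\infty)$ be any positive edge weights, and let $d_G$ be the shortest-path metric of $(G,w)$ on $V$. Then there are $3^s$ finite trees $T_1,\dots,T_{3^s}$ with positive edge weights, each with $V\subseteq V(T_i)$ (additional Steiner vertices are allowed), such that, writing $d_{T_i}(x,y)$ for the length of the path from $x$ to $y$ in $T_i$: 1. (domination) $d_{T_i}(x,y)\ge d_G(x,y)$ for all $i$ and all $x,y\in V$; 2. (distortion) $C s^4\ge 1$, and for all $x\ne y$ in $V$ there is an index $i$ with $d_{T_i}(x,y)\le C s^4\, d_G(x,y)$; 3. (ultrametrics) the restriction of each $d_{T_i}$ to $V$ is an ultrametric, i.e. $d_{T_i}(x,z)\le\max\{d_{T_i}(x,y),d_{T_i}(y,z)\}$ for all $x,y,z\in V$. That is, $(V,d_G)$ has a tree cover with distortion $O(s^4)$ consisting of $3^s$ ultrametrics. -/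

import Mathlib

universe u v

noncomputable section

/-- `H` is a minor of `G`: there are pairwise disjoint branch sets in `G`, one for each vertex
of `H`, each inducing a (nonempty) connected subgraph, such that branch sets of adjacent
vertices of `H` are joined by an edge of `G`. -/
def IsGraphMinor {W : Type v} {V : Type u} (H : SimpleGraph W) (G : SimpleGraph V) : Prop :=
  ∃ B : W → Set V,
    (∀ a, (G.induce (B a)).Connected) ∧
    (∀ a b, a ≠ b → Disjoint (B a) (B b)) ∧
    (∀ a b, H.Adj a b → ∃ x ∈ B a, ∃ y ∈ B b, G.Adj x y)

/-- `G` does not contain the complete bipartite graph `K_{s,s}` as a minor. -/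
def KssMinorFree {V : Type u} (s : ℕ) (G : SimpleGraph V) : Prop :=
  ¬ IsGraphMinor (completeBipartiteGraph (Fin s) (Fin s)) G

/-- The length of a walk with respect to edge weights `w`. -/
def walkLength {V : Type u} {G : SimpleGraph V} (w : Sym2 V → ℝ) {x y : V}
    (p : G.Walk x y) : ℝ :=
  (p.edges.map w).sum

/-- The shortest-path distance of the edge-weighted graph `(G, w)`. It is used only for
connected graphs with positive edge weights. -/
def pathDist {V : Type u} (G : SimpleGraph V) (w : Sym2 V → ℝ) (x y : V) : ℝ :=
  ⨅ p : G.Walk x y, walkLength w p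

/-- A finite tree with positive edge weights whose vertex set contains (a copy of) `X`.
Vertices outside `X` are Steiner points. -/
structure WeightedTree (X : Type u) where
  Vert : Type u
  finite_vert : Finite Vert
  graph : SimpleGraph Vert
  isTree : graph.IsTree
  weight : Sym2 Vert → ℝ
  weight_pos : ∀ e ∈ graph.edgeSet, 0 < weight e
  point : X ↪ Vert

namespace WeightedTree

variable {X : Type u}

/-- The tree distance between two points of `X`. In a tree with positive weights the shortest
walk is the unique path. -/
def treeDist (T : WeightedTree X) (x y : X) : ℝ :=
  pathDist T.graph T.weight (T.point x) (T.point y)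

/-- `T` dominates the distance function `d` on `X`. -/
def Dominating (T : WeightedTree X) (d : X → X → ℝ) : Prop :=
  ∀ x y, d x y ≤ T.treeDist x y

/-- The tree metric induced by `T` on `X` is an ultrametric. -/
def IsUltrametric (T : WeightedTree X) : Prop :=
  @IsUltrametricDist X ⟨T.treeDist⟩

end WeightedTree

/-- The trees `T i` form a tree cover of `(X, d)` with distortion `α` and size `k`. -/
def IsTreeCover {X : Type u} (d : X → X → ℝ) (α : ℝ) (k : ℕ)
    (T : Fin k → WeightedTree X) : Prop :=
  1 ≤ α ∧
  (∀ i, (T i).Dominating d) ∧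
  ∀ x y, x ≠ y → ∃ i, (T i).treeDist x y ≤ α * d x y

end

/-! ### Walk lengths and shortest-path distances. -/

section PathDist

variable {V : Type u} {G H : SimpleGraph V} {w : Sym2 V → ℝ}

/-! The proof combines a Klein–Plotkin–Rao decomposition with a hierarchy of partitions.

At scale `D`, delete the edges longer than `D / 4`. Then, `s` times, cut every current component
into layers of width `D` by distance from a root of that component. The three offsets allowed in
each round give `3 ^ s` partitions. Around any vertex, one of the three offsets in each round leaves
a ball of radius `D / 4` uncut (`exists_chop_padded`).

Cells have diameter at most `20 s² D` in `G` (`pathDist_le_of_chop_reachable`). Otherwise some cell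
contains `s` vertices pairwise more than `10 s D` apart. Undoing the rounds from the last one, each
supplies a ball around a root as a new branch set on one side of `K_{s,s}`. Shortest paths towards
that root extend the `s` branch sets on the other side (`Fan.nonempty_of_cutLayers`), which grow too
little to meet one another.

Finally, fix an offset sequence and use it at all scales `(4K)^n δ` with `K = O(s²)`. Making the
partitions nested costs a constant factor in diameter, and the resulting laminar family is a tree
inducing an ultrametric (`exists_ultrametric_tree`). A given pair needs good padding at one scale
only, so some sequence serves it with distortion `O(K²) = O(s⁴)` (`exists_ultrametric_cover`). -/

@[simp]
theorem walkLength_nil {x : V} : walkLength w (SimpleGraph.Walk.nil : G.Walk x x) = 0 := by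
  simp [walkLength]

@[simp]
theorem walkLength_cons {x y z : V} (h : G.Adj x y) (p : G.Walk y z) :
    walkLength w (SimpleGraph.Walk.cons h p) = w s(x, y) + walkLength w p := by
  simp [walkLength]

theorem walkLength_append {x y z : V} (p : G.Walk x y) (q : G.Walk y z) :
    walkLength w (p.append q) = walkLength w p + walkLength w q := by
  simp [walkLength]

theorem walkLength_concat {x y z : V} (p : G.Walk x y) (h : G.Adj y z) :
    walkLength w (p.concat h) = walkLength w p + w s(y, z) := by
  simp [walkLength, SimpleGraph.Walk.edges_concat, List.concat_eq_append]

theorem walkLength_reverse {x y : V} (p : G.Walk x y) :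
    walkLength w p.reverse = walkLength w p := by
  simp [walkLength]

theorem walkLength_mapLe {x y : V} (h : H ≤ G) (p : H.Walk x y) :
    walkLength w (p.mapLe h) = walkLength w p := by
  simp [walkLength]

theorem walkLength_nonneg (hw : ∀ e ∈ G.edgeSet, 0 < w e) {x y : V} (p : G.Walk x y) :
    0 ≤ walkLength w p := by
  refine List.sum_nonneg fun r hr => ?_
  obtain ⟨e, he, rfl⟩ := List.mem_map.1 hr
  exact (hw e (p.edges_subset_edgeSet he)).le

theorem le_walkLength_of_mem_edges (hw : ∀ e ∈ G.edgeSet, 0 < w e) {x y : V} (p : G.Walk x y)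
    {e : Sym2 V} (he : e ∈ p.edges) : w e ≤ walkLength w p := by
  refine List.single_le_sum (fun r hr => ?_) _ (List.mem_map_of_mem he)
  obtain ⟨e', he', rfl⟩ := List.mem_map.1 hr
  exact (hw e' (p.edges_subset_edgeSet he')).le

/-- A function that is Lipschitz along the edges of a graph is Lipschitz along walks. -/
theorem abs_sub_le_walkLength {φ : V → ℝ} (hφ : ∀ a b, G.Adj a b → |φ a - φ b| ≤ w s(a, b))
    {x y : V} (p : G.Walk x y) : |φ x - φ y| ≤ walkLength w p := by
  induction p with
  | nil => simp
  | @cons a b c h p ih =>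
    rw [walkLength_cons]
    exact (abs_sub_le _ (φ b) _).trans (add_le_add (hφ _ _ h) ih)

theorem pathDist_le_walkLength (hw : ∀ e ∈ G.edgeSet, 0 < w e) {x y : V} (p : G.Walk x y) :
    pathDist G w x y ≤ walkLength w p :=
  ciInf_le ⟨0, by rintro _ ⟨q, rfl⟩; exact walkLength_nonneg hw q⟩ p

theorem pathDist_nonneg (hw : ∀ e ∈ G.edgeSet, 0 < w e) (x y : V) : 0 ≤ pathDist G w x y :=
  Real.iInf_nonneg fun p => walkLength_nonneg hw p

theorem pathDist_self (hw : ∀ e ∈ G.edgeSet, 0 < w e) (x : V) : pathDist G w x x = 0 :=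
  le_antisymm ((pathDist_le_walkLength hw SimpleGraph.Walk.nil).trans_eq walkLength_nil)
    (pathDist_nonneg hw x x)

theorem pathDist_comm (x y : V) : pathDist G w x y = pathDist G w y x := by
  unfold pathDist
  refine Equiv.iInf_congr ⟨SimpleGraph.Walk.reverse, SimpleGraph.Walk.reverse,
    fun p => p.reverse_reverse, fun p => p.reverse_reverse⟩ fun p => ?_
  exact walkLength_reverse p

theorem pathDist_le_of_forall_walk {x y z t : V} {c : ℝ} (h : G.Reachable x y)
    (H' : ∀ p : G.Walk x y, pathDist H w z t ≤ c + walkLength w p) :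
    pathDist H w z t ≤ c + pathDist G w x y := by
  obtain ⟨p₀⟩ := h
  have : Nonempty (G.Walk x y) := ⟨p₀⟩
  have : pathDist H w z t - c ≤ pathDist G w x y :=
    le_ciInf fun p => by linarith [H' p]
  linarith

theorem pathDist_triangle_walk (hw : ∀ e ∈ G.edgeSet, 0 < w e) {x y z : V}
    (h : G.Reachable x y) (q : G.Walk y z) :
    pathDist G w x z ≤ pathDist G w x y + walkLength w q := by
  rw [add_comm]
  refine pathDist_le_of_forall_walk h fun p => ?_
  rw [add_comm, ← walkLength_append]
  exact pathDist_le_walkLength hw _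

theorem pathDist_triangle (hw : ∀ e ∈ G.edgeSet, 0 < w e) {x y z : V}
    (h : G.Reachable x y) (h' : G.Reachable y z) :
    pathDist G w x z ≤ pathDist G w x y + pathDist G w y z :=
  pathDist_le_of_forall_walk h' fun q => pathDist_triangle_walk hw h q

theorem pathDist_anti (hw : ∀ e ∈ G.edgeSet, 0 < w e) (hle : H ≤ G) {x y : V}
    (h : H.Reachable x y) : pathDist G w x y ≤ pathDist H w x y := by
  rw [← zero_add (pathDist H w x y)]
  refine pathDist_le_of_forall_walk h fun p => ?_
  rw [zero_add, ← walkLength_mapLe hle]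
  exact pathDist_le_walkLength hw _

theorem abs_pathDist_sub_le (hw : ∀ e ∈ G.edgeSet, 0 < w e) {r x y : V}
    (h : G.Reachable r x) (hxy : G.Adj x y) :
    |pathDist G w r x - pathDist G w r y| ≤ w s(x, y) := by
  have h1 := pathDist_triangle_walk hw h hxy.toWalk
  have h2 := pathDist_triangle_walk hw (h.trans hxy.reachable) hxy.symm.toWalk
  simp only [SimpleGraph.Adj.toWalk, walkLength_cons, walkLength_nil, add_zero] at h1 h2
  rw [Sym2.eq_swap] at h2
  rw [abs_le]
  constructor <;> linarith

/-- Every vertex other than the root has a neighbour that precedes it on a shortest path. -/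
theorem exists_adj_pathDist_eq [Finite V] (hw : ∀ e ∈ G.edgeSet, 0 < w e) {r x : V}
    (h : G.Reachable r x) (hne : x ≠ r) :
    ∃ y, G.Adj x y ∧ pathDist G w r x = pathDist G w r y + w s(x, y) := by
  have : Nonempty {y // G.Adj x y} := by
    obtain ⟨p⟩ := h.symm
    cases p with
    | nil => exact absurd rfl hne
    | cons h p => exact ⟨⟨_, h⟩⟩
  obtain ⟨⟨y, hy⟩, hmin⟩ :=
    Finite.exists_min fun y : {y // G.Adj x y} => pathDist G w r y + w s(x, y)
  refine ⟨y, hy, le_antisymm ?_ ?_⟩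
  · have := pathDist_triangle_walk (x := r) hw (h.trans hy.reachable) hy.symm.toWalk
    simp only [SimpleGraph.Adj.toWalk, walkLength_cons, walkLength_nil, add_zero] at this
    rwa [Sym2.eq_swap] at this
  · rw [pathDist_comm r x]
    obtain ⟨p₀⟩ := h.symm
    have : Nonempty (G.Walk x r) := ⟨p₀⟩
    refine le_ciInf fun p => ?_
    cases p with
    | nil => exact absurd rfl hne
    | @cons _ z _ h p =>
      refine (hmin ⟨z, h⟩).trans ?_
      rw [walkLength_cons, pathDist_comm r]
      linarith [pathDist_le_walkLength hw p]

theorem pathDist_pos [Finite V] (hw : ∀ e ∈ G.edgeSet, 0 < w e) {x y : V}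
    (h : G.Reachable x y) (hne : x ≠ y) : 0 < pathDist G w x y := by
  obtain ⟨z, hz, e⟩ := exists_adj_pathDist_eq hw h hne.symm
  have h1 := hw s(y, z) hz
  have h2 := pathDist_nonneg hw x z
  linarith

end PathDist

/-! ### Shortest paths towards the roots of components. -/

section Descent

variable {V : Type u} {G H : SimpleGraph V} {w : Sym2 V → ℝ}

/-- The root chosen in the connected component of `x`. -/
noncomputable def compRoot (H : SimpleGraph V) (x : V) : V :=
  Quot.out (H.connectedComponentMk x)

theorem reachable_compRoot (H : SimpleGraph V) (x : V) : H.Reachable (compRoot H x) x :=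
  SimpleGraph.ConnectedComponent.exact (Quot.out_eq (H.connectedComponentMk x))

theorem compRoot_eq_of_reachable {x y : V} (h : H.Reachable x y) : compRoot H x = compRoot H y := by
  unfold compRoot
  rw [SimpleGraph.ConnectedComponent.sound h]

/-- The distance of a vertex from the root of its component. -/
noncomputable def rootDist (H : SimpleGraph V) (w : Sym2 V → ℝ) (x : V) : ℝ :=
  pathDist H w (compRoot H x) x

theorem rootDist_compRoot (hw : ∀ e ∈ H.edgeSet, 0 < w e) (x : V) :
    rootDist H w (compRoot H x) = 0 := by
  unfold rootDist
  rw [compRoot_eq_of_reachable (reachable_compRoot H x)]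
  exact pathDist_self hw _

theorem abs_rootDist_sub_le (hw : ∀ e ∈ H.edgeSet, 0 < w e) (x y : V) (h : H.Adj x y) :
    |rootDist H w x - rootDist H w y| ≤ w s(x, y) := by
  unfold rootDist
  rw [← compRoot_eq_of_reachable h.reachable]
  exact abs_pathDist_sub_le hw (reachable_compRoot H x) h

theorem abs_rootDist_sub_le_walkLength (hw : ∀ e ∈ H.edgeSet, 0 < w e) {x y : V}
    (p : H.Walk x y) : |rootDist H w x - rootDist H w y| ≤ walkLength w p :=
  abs_sub_le_walkLength (abs_rootDist_sub_le hw) p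

theorem exists_adj_rootDist_eq [Finite V] (hw : ∀ e ∈ H.edgeSet, 0 < w e) {x : V}
    (hx : 0 < rootDist H w x) :
    ∃ y, H.Adj x y ∧ rootDist H w x = rootDist H w y + w s(x, y) := by
  have hne : x ≠ compRoot H x := by
    intro h
    rw [h, rootDist_compRoot hw] at hx
    exact hx.false
  obtain ⟨y, hy, e⟩ := exists_adj_pathDist_eq hw (reachable_compRoot H x) hne
  refine ⟨y, hy, ?_⟩
  unfold rootDist
  rw [← compRoot_eq_of_reachable hy.reachable]
  exact e

/-- Induction on the values of a real function on a finite type. -/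
theorem induction_on_value [Finite V] (f : V → ℝ) {P : V → Prop}
    (h : ∀ x, (∀ y, f y < f x → P y) → P x) (x : V) : P x := by
  have hwf : WellFounded fun a b : V => f a < f b :=
    have : IsTrans V fun a b => f a < f b := ⟨fun _ _ _ => lt_trans⟩
    have : Std.Irrefl fun a b : V => f a < f b := ⟨fun _ => lt_irrefl _⟩
    Finite.wellFounded_of_trans_of_irrefl _
  exact hwf.induction x h

/-- From every vertex one can descend along a shortest path towards the root until the distance
from the root drops to a given threshold. -/
theorem exists_descent [Finite V] (hw : ∀ e ∈ H.edgeSet, 0 < w e) {θ : ℝ} (hθ : 0 ≤ θ) (x : V)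
    (hx : θ < rootDist H w x) :
    ∃ z u, ∃ p : H.Walk x z, walkLength w p = rootDist H w x - rootDist H w z ∧
      θ < rootDist H w z ∧ H.Adj z u ∧ rootDist H w u ≤ θ ∧
      rootDist H w z = rootDist H w u + w s(z, u) := by
  induction x using induction_on_value (rootDist H w) with | h x ih
  obtain ⟨y, hy, e⟩ := exists_adj_rootDist_eq hw (hθ.trans_lt hx)
  rcases le_or_gt (rootDist H w y) θ with h | h
  · exact ⟨x, y, SimpleGraph.Walk.nil, by simp, hx, hy, h, e⟩
  · have hpos := hw s(x, y) hy
    obtain ⟨z, u, p, h1, h2⟩ := ih y (by linarith) h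
    exact ⟨z, u, SimpleGraph.Walk.cons hy p, by rw [walkLength_cons, h1]; linarith, h2⟩

/-- Along a shortest path towards the root, the distance from the root decreases. -/
theorem descent_prefix (hw : ∀ e ∈ H.edgeSet, 0 < w e) {x z v : V} (p : H.Walk x z)
    (hp : walkLength w p = rootDist H w x - rootDist H w z) (hv : v ∈ p.support) :
    rootDist H w z ≤ rootDist H w v ∧ rootDist H w v ≤ rootDist H w x ∧
      ∃ q : H.Walk x v, walkLength w q = rootDist H w x - rootDist H w v := by
  classical
  -- Each of the two pieces is at least as long as its drop in `rootDist`. The lengths and the drops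
  -- have the same sum, so both bounds are equalities.
  have h := congrArg (walkLength w) (p.take_spec hv)
  rw [walkLength_append] at h
  have h1 := (abs_le.1 (abs_rootDist_sub_le_walkLength hw (p.takeUntil v hv))).2
  have h2 := (abs_le.1 (abs_rootDist_sub_le_walkLength hw (p.dropUntil v hv))).2
  have h3 := walkLength_nonneg hw (p.takeUntil v hv)
  have h4 := walkLength_nonneg hw (p.dropUntil v hv)
  exact ⟨by linarith, by linarith, p.takeUntil v hv, by linarith⟩

/-- Balls around the root of a component are connected. -/
theorem connected_induce_rootDist_le [Finite V] (hw : ∀ e ∈ H.edgeSet, 0 < w e) (x : V) {θ : ℝ}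
    (hθ : 0 ≤ θ) : (H.induce {v | H.Reachable x v ∧ rootDist H w v ≤ θ}).Connected := by
  set S : Set V := {v | H.Reachable x v ∧ rootDist H w v ≤ θ}
  have hr : compRoot H x ∈ S := ⟨(reachable_compRoot H x).symm, by
    rw [rootDist_compRoot hw]; exact hθ⟩
  rw [SimpleGraph.connected_iff_exists_forall_reachable]
  refine ⟨⟨_, hr⟩, ?_⟩
  rintro ⟨v, hv⟩
  induction v using induction_on_value (rootDist H w) with | h v ih
  by_cases hvr : v = compRoot H x
  · subst hvr
    exact SimpleGraph.Reachable.refl _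
  · have e : compRoot H v = compRoot H x := (compRoot_eq_of_reachable hv.1).symm
    rw [← e] at hvr
    obtain ⟨y, hy, e'⟩ := exists_adj_pathDist_eq hw (reachable_compRoot H v) hvr
    have hpos := hw s(v, y) hy
    have e'' : rootDist H w v = rootDist H w y + w s(v, y) := by
      unfold rootDist
      rw [← compRoot_eq_of_reachable hy.reachable]
      exact e'
    have hyS : y ∈ S := ⟨hv.1.trans hy.reachable, by linarith [hv.2]⟩
    refine (ih y (by linarith) hyS).trans ?_
    exact SimpleGraph.Adj.reachable (G := H.induce S) (u := ⟨y, hyS⟩) (v := ⟨v, hv⟩) hy.symm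

end Descent

/-! ### Cutting into layers, and padding. -/

section Chop

variable {V : Type u} {G H : SimpleGraph V} {w : Sym2 V → ℝ}

/-- The index of the layer of width `D` that contains `x`, where `a / 3` is the offset. -/
noncomputable def layer (H : SimpleGraph V) (w : Sym2 V → ℝ) (D : ℝ) (a : Fin 3) (x : V) : ℤ :=
  ⌊rootDist H w x / D + (a : ℕ) / 3⌋

/-- Delete the edges between different layers. -/
noncomputable def cutLayers (H : SimpleGraph V) (w : Sym2 V → ℝ) (D : ℝ) (a : Fin 3) : SimpleGraph V where
  Adj x y := H.Adj x y ∧ layer H w D a x = layer H w D a y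
  symm := ⟨fun _ _ h => ⟨h.1.symm, h.2.symm⟩⟩
  loopless := ⟨fun _ h => h.1.ne rfl⟩

/-- Delete the edges of weight greater than `ε`. -/
def shortEdges (G : SimpleGraph V) (w : Sym2 V → ℝ) (ε : ℝ) : SimpleGraph V where
  Adj x y := G.Adj x y ∧ w s(x, y) ≤ ε
  symm := ⟨fun _ _ h => ⟨h.1.symm, by rw [Sym2.eq_swap]; exact h.2⟩⟩
  loopless := ⟨fun _ h => h.1.ne rfl⟩

/-- Delete the long edges, and then repeatedly cut all components into layers. -/
noncomputable def chop (G : SimpleGraph V) (w : Sym2 V → ℝ) (D : ℝ) : List (Fin 3) → SimpleGraph V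
  | [] => shortEdges G w (D / 4)
  | a :: l => cutLayers (chop G w D l) w D a

theorem cutLayers_le (D : ℝ) (a : Fin 3) : cutLayers H w D a ≤ H := fun _ _ h => h.1

theorem chop_le_shortEdges (D : ℝ) (l : List (Fin 3)) : chop G w D l ≤ shortEdges G w (D / 4) := by
  induction l with
  | nil => exact le_rfl
  | cons a l ih => exact (cutLayers_le D a).trans ih

theorem chop_le (D : ℝ) (l : List (Fin 3)) : chop G w D l ≤ G :=
  (chop_le_shortEdges D l).trans fun _ _ h => h.1

theorem weight_pos_of_le (hle : H ≤ G) (hw : ∀ e ∈ G.edgeSet, 0 < w e) :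
    ∀ e ∈ H.edgeSet, 0 < w e :=
  fun e he => hw e (SimpleGraph.edgeSet_mono hle he)

theorem layer_eq_of_reachable {D : ℝ} {a : Fin 3} {x y : V}
    (h : (cutLayers H w D a).Reachable x y) : layer H w D a x = layer H w D a y := by
  obtain ⟨p⟩ := h
  induction p with
  | nil => rfl
  | cons h p ih => exact h.2.trans ih

theorem layer_eq_iff {D : ℝ} (hD : 0 < D) {a : Fin 3} {x : V} {k : ℤ} :
    layer H w D a x = k ↔
      (k - (a : ℕ) / 3) * D ≤ rootDist H w x ∧ rootDist H w x < (k - (a : ℕ) / 3) * D + D := by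
  unfold layer
  rw [Int.floor_eq_iff, ← sub_le_iff_le_add, ← lt_sub_iff_add_lt, le_div_iff₀ hD, div_lt_iff₀ hD]
  refine and_congr Iff.rfl ?_
  rw [show (k + 1 - ((a : ℕ) : ℝ) / 3) * D = (k - ((a : ℕ) : ℝ) / 3) * D + D by ring]

/-- A walk that stays in one layer survives the cut. -/
theorem exists_walk_cutLayers {D : ℝ} {a : Fin 3} {k : ℤ} {x y : V} (p : H.Walk x y)
    (hp : ∀ v ∈ p.support, layer H w D a v = k) :
    ∃ q : (cutLayers H w D a).Walk x y, walkLength w q = walkLength w p := by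
  refine ⟨p.transfer _ fun e he => ?_, by simp [walkLength]⟩
  induction e with
  | h u v =>
    exact ⟨p.adj_of_mem_edges he,
      (hp u (p.fst_mem_support_of_mem_edges he)).trans
        (hp v (p.snd_mem_support_of_mem_edges he)).symm⟩

/-- For a suitable offset, a given number is far from the boundaries of its layer. -/
theorem exists_offset (t : ℝ) : ∃ a : Fin 3, ∀ t' : ℝ, |t - t'| ≤ 1 / 4 →
    ⌊t + ((a : ℕ) : ℝ) / 3⌋ = ⌊t' + ((a : ℕ) : ℝ) / 3⌋ := by
  have h0 := Int.fract_nonneg t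
  have h1 := Int.fract_lt_one t
  have h2 := Int.floor_add_fract t
  have key : ∀ (a : Fin 3) (k : ℤ), k + 1 / 4 ≤ t + ((a : ℕ) : ℝ) / 3 →
      t + ((a : ℕ) : ℝ) / 3 < k + 3 / 4 → ∀ t' : ℝ, |t - t'| ≤ 1 / 4 →
      ⌊t + ((a : ℕ) : ℝ) / 3⌋ = ⌊t' + ((a : ℕ) : ℝ) / 3⌋ := by
    intro a k hk hk' t' ht'
    rw [abs_le] at ht'
    have hk1 : ⌊t + ((a : ℕ) : ℝ) / 3⌋ = k := Int.floor_eq_iff.2 ⟨by linarith, by linarith⟩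
    rw [hk1, eq_comm, Int.floor_eq_iff]
    constructor <;> linarith
  -- The offset moves `t` into the middle third of a unit interval, so both ends are more than `1 /
  -- 4` away.
  rcases lt_or_ge (Int.fract t) (1 / 3) with h | h
  · refine ⟨1, key 1 ⌊t⌋ ?_ ?_⟩ <;> norm_num <;> linarith
  rcases lt_or_ge (Int.fract t) (2 / 3) with h' | h'
  · refine ⟨0, key 0 ⌊t⌋ ?_ ?_⟩ <;> norm_num <;> linarith
  · refine ⟨2, key 2 (⌊t⌋ + 1) ?_ ?_⟩ <;> norm_num <;> linarith

/-- For every vertex there is a sequence of offsets for which no short walk from it is cut. -/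
theorem exists_chop_padded (hw : ∀ e ∈ G.edgeSet, 0 < w e) {D : ℝ} (hD : 0 < D) (x : V) (n : ℕ) :
    ∃ l : List (Fin 3), l.length = n ∧
      ∀ (y : V) (p : G.Walk x y), walkLength w p ≤ D / 4 →
        ∀ e ∈ p.edges, e ∈ (chop G w D l).edgeSet := by
  induction n with
  | zero =>
    refine ⟨[], rfl, fun y p hp e he => ?_⟩
    have h := (le_walkLength_of_mem_edges hw p he).trans hp
    induction e with
    | h a b => exact ⟨p.adj_of_mem_edges he, h⟩
  | succ n ih =>
    classical
    obtain ⟨l, hl, hpad⟩ := ih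
    set H := chop G w D l
    have hwH : ∀ e ∈ H.edgeSet, 0 < w e := weight_pos_of_le (chop_le D l) hw
    obtain ⟨a, ha⟩ := exists_offset (rootDist H w x / D)
    refine ⟨a :: l, by simp [hl], fun y p hp e he => ?_⟩
    have hlay : ∀ v ∈ p.support, layer H w D a x = layer H w D a v := by
      intro v hv
      refine ha _ ?_
      -- The prefix up to `v` is short too, so it survives in `H` by induction. This is needed
      -- because `rootDist H` is Lipschitz only along walks of `H`.
      have hle : walkLength w (p.takeUntil v hv) ≤ D / 4 := by
        have h := congrArg (walkLength w) (p.take_spec hv)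
        rw [walkLength_append] at h
        linarith [walkLength_nonneg hw (p.dropUntil v hv)]
      have h := abs_rootDist_sub_le_walkLength hwH
        ((p.takeUntil v hv).transfer H (hpad v _ hle))
      have e1 : walkLength w ((p.takeUntil v hv).transfer H (hpad v _ hle)) =
          walkLength w (p.takeUntil v hv) := by simp [walkLength]
      rw [e1] at h
      rw [← sub_div, abs_div, abs_of_pos hD, div_le_iff₀ hD]
      linarith
    have heH := hpad y p hp e he
    induction e with
    | h u v =>
      exact ⟨heH, (hlay u (p.fst_mem_support_of_mem_edges he)).symm.trans
        (hlay v (p.snd_mem_support_of_mem_edges he))⟩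

end Chop

/-! ### Minors from large cells: the weak diameter bound. -/

section Fan

variable {V : Type u} {G H : SimpleGraph V} {w : Sym2 V → ℝ}

theorem connected_induce_mono (hle : H ≤ G) {S : Set V} (h : (H.induce S).Connected) :
    (G.induce S).Connected :=
  h.mono fun _ _ hab => hle hab

theorem pathDist_le_of_walk_le (hw : ∀ e ∈ G.edgeSet, 0 < w e) (hle : H ≤ G) {x y : V}
    (p : H.Walk x y) : pathDist G w x y ≤ walkLength w p := by
  rw [← walkLength_mapLe hle]
  exact pathDist_le_walkLength hw _

/-- A model of `K_{s,m}` in the component of `x₀` in `H`: the branch sets `A j` contain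
terminals `t j` that are far from the branch sets `T k`, and lie in balls around `a j`. -/
structure Fan (G H : SimpleGraph V) (w : Sym2 V → ℝ) (D : ℝ) (x₀ : V) {s : ℕ} (a : Fin s → V)
    (m : ℕ) where
  t : Fin s → V
  A : Fin s → Set V
  T : Fin m → Set V
  t_mem : ∀ j, t j ∈ A j
  A_conn : ∀ j, (G.induce (A j)).Connected
  A_near : ∀ j, ∀ v ∈ A j, pathDist G w (a j) v ≤ 5 * m * D
  A_reach : ∀ j, ∀ v ∈ A j, H.Reachable x₀ v
  T_conn : ∀ k, (G.induce (T k)).Connected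
  T_reach : ∀ k, ∀ v ∈ T k, H.Reachable x₀ v
  T_disj : ∀ k l, k ≠ l → Disjoint (T k) (T l)
  A_disj_T : ∀ j k, Disjoint (A j) (T k)
  adj : ∀ j k, ∃ x ∈ A j, ∃ y ∈ T k, G.Adj x y
  sep : ∀ j k, ∀ v ∈ T k, ∀ p : H.Walk (t j) v, D < walkLength w p

/-- The fan without branch sets `T k`. -/
def Fan.base (hw : ∀ e ∈ G.edgeSet, 0 < w e) (D : ℝ) {x₀ : V} {s : ℕ} {a : Fin s → V}
    (ha : ∀ j, H.Reachable x₀ (a j)) : Fan G H w D x₀ a 0 where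
  t := a
  A j := {a j}
  T := Fin.elim0
  t_mem _ := rfl
  A_conn j := by
    have : Nonempty ({a j} : Set V) := ⟨⟨a j, rfl⟩⟩
    exact SimpleGraph.Connected.mk (SimpleGraph.Preconnected.of_subsingleton)
  A_near j v hv := by
    rw [Set.mem_singleton_iff.1 hv, pathDist_self hw]
    simp
  A_reach j v hv := by
    rw [Set.mem_singleton_iff.1 hv]
    exact ha j
  T_conn k := k.elim0
  T_reach k := k.elim0
  T_disj k := k.elim0
  A_disj_T _ k := k.elim0
  adj _ k := k.elim0
  sep _ k := k.elim0

/-- A shortest path from a terminal towards the root of the component, which ends next to the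
ball of radius `ρ - 4 D` around the root and visits a new terminal on its way. -/
theorem exists_tail [Finite V] (hw : ∀ e ∈ H.edgeSet, 0 < w e) {D : ℝ} (hD : 0 < D)
    (hshort : ∀ e ∈ H.edgeSet, w e ≤ D / 4) {ρ : ℝ} (hρ : 4 * D ≤ ρ) (x : V)
    (hx : ρ ≤ rootDist H w x) :
    ∃ x' z u, ∃ p : H.Walk x z, walkLength w p = rootDist H w x - rootDist H w z ∧
      x' ∈ p.support ∧ rootDist H w x' ≤ ρ - 2 * D ∧ ρ - 2 * D - D / 4 < rootDist H w x' ∧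
      ρ - 4 * D < rootDist H w z ∧ H.Adj z u ∧ rootDist H w u ≤ ρ - 4 * D := by
  -- The descent is made in two legs, with thresholds `ρ - 2 * D` and `ρ - 4 * D`. The end `x'` of
  -- the first leg overshoots by less than one edge, hence by less than `D / 4`.
  obtain ⟨z, x', p, hp, hz, hzx', hx', e⟩ :=
    exists_descent hw (θ := ρ - 2 * D) (by linarith) x (by linarith)
  have h1 := hshort s(z, x') hzx'
  obtain ⟨z', u, q, hq, hz', hzu, hu, -⟩ :=
    exists_descent hw (θ := ρ - 4 * D) (by linarith) x' (by linarith)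
  refine ⟨x', z', u, (p.concat hzx').append q, ?_, ?_, hx', by linarith, hz', hzu, hu⟩
  · rw [walkLength_append, walkLength_concat, hp, hq, e]
    ring
  · rw [SimpleGraph.Walk.mem_support_append_iff]
    exact Or.inl (SimpleGraph.Walk.end_mem_support _)

/-- Undoing one cut exposes the part of the component of `H` nearer to its root than the layer of
`x₀`. The ball of radius `ρ - 4 * D` there becomes the new `T`, where `ρ` is the inner boundary of
the layer. Descending tails join every `A j` to it. The new terminals sit near depth `ρ - 2 * D`,
more than `D` in depth from this ball and from the old sets `T k`, which lie in the layer. -/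
theorem Fan.nonempty_of_cutLayers [Finite V] (hG : G.Connected) (hw : ∀ e ∈ G.edgeSet, 0 < w e)
    (hle : H ≤ G) {D : ℝ} (hD : 0 < D) (hshort : ∀ e ∈ H.edgeSet, w e ≤ D / 4) {x₀ y₀ : V}
    {c : Fin 3} (hy₀ : (cutLayers H w D c).Reachable x₀ y₀)
    (hfar : 10 * D < pathDist G w x₀ y₀) {s m : ℕ} {a : Fin s → V}
    (F : Fan G (cutLayers H w D c) w D x₀ a m) : Nonempty (Fan G H w D x₀ a (m + 1)) := by
  have hwH := weight_pos_of_le hle hw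
  set H' := cutLayers H w D c with hH'
  have hle' : H' ≤ H := cutLayers_le D c
  set f := rootDist H w with hf
  set κ := layer H w D c x₀
  set ρ : ℝ := (κ - (c : ℕ) / 3) * D
  have hlay : ∀ v, H'.Reachable x₀ v → ρ ≤ f v ∧ f v < ρ + D := fun v hv =>
    (layer_eq_iff hD).1 (layer_eq_of_reachable hv).symm
  have hlip : ∀ {x y : V} (p : H.Walk x y), |f x - f y| ≤ walkLength w p :=
    fun p => abs_rootDist_sub_le_walkLength hwH p
  -- Otherwise `x₀` and `y₀`, both at depth less than `ρ + D`, would be joined through the root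
  -- within `10 * D`.
  have hρ : 4 * D < ρ := by
    by_contra! hcon
    have hr := hy₀.mono hle'
    have h1 := pathDist_triangle hw ((reachable_compRoot H x₀).symm.mono hle)
      ((reachable_compRoot H y₀).mono hle |> fun h => compRoot_eq_of_reachable hr ▸ h)
    rw [pathDist_comm x₀ (compRoot H x₀)] at h1
    have h2 := pathDist_anti hw hle (reachable_compRoot H x₀)
    have h3 := pathDist_anti hw hle (reachable_compRoot H y₀)
    rw [← compRoot_eq_of_reachable hr] at h3
    have h4 := (hlay x₀ (SimpleGraph.Reachable.refl _)).2
    have h5 := (hlay y₀ hy₀).2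
    simp only [hf, rootDist] at h4 h5
    rw [← compRoot_eq_of_reachable hr] at h5
    linarith
  have htr : ∀ j, H'.Reachable x₀ (F.t j) := fun j => F.A_reach j _ (F.t_mem j)
  choose t z u p hp htp ht1 ht2 hz hzu hu using fun j =>
    exists_tail hwH hD hshort hρ.le (F.t j) (hlay _ (htr j)).1
  have hpre : ∀ j, ∀ v ∈ (p j).support, _ := fun j v hv => descent_prefix hwH (p j) (hp j) hv
  have hreach : ∀ j, ∀ v ∈ (p j).support, H.Reachable x₀ v := fun j v hv =>
    ((htr j).mono hle').trans ⟨(hpre j v hv).2.2.choose⟩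
  set T₀ : Set V := {v | H.Reachable x₀ v ∧ f v ≤ ρ - 4 * D}
  have hT₀ : ∀ v, H'.Reachable x₀ v → v ∉ T₀ := fun v hv hv' => by
    linarith [hv'.2, (hlay v hv).1]
  refine ⟨{
    t := t
    A := fun j => F.A j ∪ {v | v ∈ (p j).support}
    T := Fin.cons T₀ F.T
    t_mem := fun j => Or.inr (htp j)
    A_conn := fun j => ?_
    A_near := ?_
    A_reach := ?_
    T_conn := ?_
    T_reach := ?_
    T_disj := ?_
    A_disj_T := ?_
    adj := ?_
    sep := ?_ }⟩
  · exact SimpleGraph.induce_union_connected (F.A_conn j).preconnected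
      (connected_induce_mono hle (p j).connected_induce_support).preconnected
      ⟨F.t j, F.t_mem j, (p j).start_mem_support⟩
  · intro j v hv
    push_cast
    rcases hv with hv | hv
    · nlinarith [F.A_near j v hv]
    -- A tail starts at depth below `ρ + D` and ends above `ρ - 4 * D`, so it adds less than `5 *
    -- D`.
    · obtain ⟨-, -, q, hq⟩ := hpre j v hv
      have h3 := pathDist_triangle hw (hG.preconnected (a j) (F.t j)) (hG.preconnected (F.t j) v)
      have h4 := pathDist_le_of_walk_le hw hle q
      have h5 := F.A_near j _ (F.t_mem j)
      have h6 := (hlay _ (htr j)).2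
      have h7 := (hpre j v hv).1
      have h8 := hz j
      linarith
  · rintro j v (hv | hv)
    · exact (F.A_reach j v hv).mono hle'
    · exact hreach j v hv
  · refine Fin.cases ?_ fun k => F.T_conn k
    exact connected_induce_mono hle (connected_induce_rootDist_le hwH x₀ (by linarith))
  · exact Fin.cases (fun v hv => hv.1) fun k v hv => (F.T_reach k v hv).mono hle'
  · refine Fin.cases (Fin.cases (fun h => absurd rfl h) fun l _ => ?_)
      fun k => Fin.cases (fun _ => ?_) fun l h => F.T_disj k l fun e => h (by rw [e])
    · exact Set.disjoint_left.2 fun v hv hv' => hT₀ v (F.T_reach l v hv') hv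
    · exact Set.disjoint_left.2 fun v hv hv' => hT₀ v (F.T_reach k v hv) hv'
  · refine fun j => Fin.cases ?_ fun k => ?_
    · refine Set.disjoint_left.2 ?_
      rintro v (hv | hv) hv'
      · exact hT₀ v (F.A_reach j v hv) hv'
      · linarith [(hpre j v hv).1, hz j, hv'.2]
    · refine Set.disjoint_left.2 ?_
      rintro v (hv | hv) hv'
      · exact Set.disjoint_left.1 (F.A_disj_T j k) hv hv'
      · obtain ⟨-, -, q, hq⟩ := hpre j v hv
        have hvρ := hlay v (F.T_reach k v hv')
        have htρ := hlay _ (htr j)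
        -- If a tail met an old `T k` at `v`, its part before `v` would stay in the layer by
        -- monotonicity. It would then survive the cut with length below `D`, against `F.sep`.
        obtain ⟨q', hq'⟩ := exists_walk_cutLayers (D := D) (a := c) (k := κ) q fun v' hv' => by
          obtain ⟨h3, h4, -⟩ := descent_prefix hwH q hq hv'
          exact (layer_eq_iff hD).2 ⟨hvρ.1.trans h3, h4.trans_lt htρ.2⟩
        have := F.sep j k v hv' q'
        linarith
  · refine fun j => Fin.cases ?_ fun k => ?_
    · exact ⟨z j, Or.inr (p j).end_mem_support, u j,
        ⟨(hreach j _ (p j).end_mem_support).trans (hzu j).reachable, hu j⟩, hle (hzu j)⟩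
    · obtain ⟨x, hx, y, hy, h⟩ := F.adj j k
      exact ⟨x, Or.inl hx, y, hy, h⟩
  · refine fun j => Fin.cases (fun v hv q => ?_) fun k v hv q => ?_
    · have h1 := abs_le.1 (hlip q)
      linarith [hv.2, ht2 j]
    · have h1 := abs_le.1 (hlip q)
      linarith [(hlay v (F.T_reach k v hv)).1, ht1 j]

/-- The head of the list is the last cut made, so induction on the list undoes the cuts in reverse
order and gains one branch set per round. -/
theorem Fan.nonempty_of_chop [Finite V] (hG : G.Connected) (hw : ∀ e ∈ G.edgeSet, 0 < w e)
    {D : ℝ} (hD : 0 < D) {x₀ y₀ : V} (hfar : 10 * D < pathDist G w x₀ y₀) {s : ℕ}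
    {a : Fin s → V} (l : List (Fin 3)) (hy₀ : (chop G w D l).Reachable x₀ y₀) {m : ℕ}
    (F : Nonempty (Fan G (chop G w D l) w D x₀ a m)) :
    Nonempty (Fan G (shortEdges G w (D / 4)) w D x₀ a (m + l.length)) := by
  induction l generalizing m with
  | nil => exact F
  | cons c l ih =>
    have hshort : ∀ e ∈ (chop G w D l).edgeSet, w e ≤ D / 4 := by
      intro e he
      induction e with
      | h x y => exact (chop_le_shortEdges D l he).2
    have h := ih (hy₀.mono (cutLayers_le D c)) (m := m + 1)
      (F.elim fun F => F.nonempty_of_cutLayers hG hw (chop_le D l) hD hshort hy₀ hfar)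
    rwa [add_assoc, add_comm 1] at h

/-- A fan around terminals that are far apart is a model of `K_{s,s}`. -/
theorem Fan.isGraphMinor (hG : G.Connected) (hw : ∀ e ∈ G.edgeSet, 0 < w e) {D : ℝ} {x₀ : V}
    {s : ℕ} {a : Fin s → V} (F : Fan G H w D x₀ a s)
    (ha : ∀ i j, i ≠ j → 10 * s * D < pathDist G w (a i) (a j)) :
    IsGraphMinor (completeBipartiteGraph (Fin s) (Fin s)) G := by
  have hA : ∀ i j, i ≠ j → Disjoint (F.A i) (F.A j) := fun i j hij =>
    Set.disjoint_left.2 fun v hv hv' => by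
      have h1 := F.A_near i v hv
      have h2 := F.A_near j v hv'
      have h3 := pathDist_triangle hw (hG.preconnected (a i) v) (hG.preconnected v (a j))
      rw [pathDist_comm v] at h3
      linarith [ha i j hij]
  refine ⟨Sum.elim F.A F.T, ?_, ?_, ?_⟩
  · rintro (j | k)
    · exact F.A_conn j
    · exact F.T_conn k
  · rintro (i | i) (j | j) hij
    · exact hA i j fun e => hij (by rw [e])
    · exact F.A_disj_T i j
    · exact (F.A_disj_T j i).symm
    · exact F.T_disj i j fun e => hij (by rw [e])
  · rintro (i | i) (j | j) hij
    · simp at hij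
    · exact F.adj i j
    · obtain ⟨x, hx, y, hy, h⟩ := F.adj j i
      exact ⟨y, hy, x, hx, h.symm⟩
    · simp at hij

/-- A real function that changes little along edges takes approximately all intermediate values. -/
theorem exists_reachable_value {f : V → ℝ} {ε : ℝ} (hf : ∀ a b, H.Adj a b → |f a - f b| ≤ ε)
    (hε : 0 ≤ ε) {x y : V} (h : H.Reachable x y) {θ : ℝ} (hx : f x ≤ θ) (hy : θ ≤ f y) :
    ∃ v, H.Reachable x v ∧ θ ≤ f v ∧ f v ≤ θ + ε := by
  obtain ⟨p⟩ := h
  induction p with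
  | nil => exact ⟨_, SimpleGraph.Reachable.refl _, hy, by linarith⟩
  | @cons a b c hab p ih =>
    rcases le_or_gt (f b) θ with h | h
    · obtain ⟨v, hv, h'⟩ := ih h hy
      exact ⟨v, hab.reachable.trans hv, h'⟩
    · exact ⟨b, hab.reachable, h.le, by linarith [(abs_le.1 (hf a b hab)).1]⟩

/-- In a graph without `K_{s,s}` minor, `s` rounds of cutting lead to components of small weak
diameter. -/
theorem pathDist_le_of_chop_reachable [Finite V] (hG : G.Connected)
    (hw : ∀ e ∈ G.edgeSet, 0 < w e) {D : ℝ} (hD : 0 < D) {s : ℕ} (hs : 1 ≤ s)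
    (hfree : KssMinorFree s G) {l : List (Fin 3)} (hl : l.length = s) {x y : V}
    (hxy : (chop G w D l).Reachable x y) : pathDist G w x y ≤ 20 * (s : ℝ) ^ 2 * D := by
  by_contra! hfar
  have hs' : (1 : ℝ) ≤ s := by exact_mod_cast hs
  have hsD : D ≤ s * D := le_mul_of_one_le_left hD.le hs'
  have hssD : s * D ≤ (s : ℝ) ^ 2 * D := by nlinarith
  have hlip : ∀ a b, (chop G w D l).Adj a b →
      |pathDist G w x a - pathDist G w x b| ≤ D / 4 := fun a b h =>
    (abs_pathDist_sub_le hw (hG.preconnected x a) (chop_le D l h)).trans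
      (chop_le_shortEdges D l h).2
  -- The spacing `11 * s * D` absorbs the overshoot `D / 4` and leaves more than `10 * s * D`, twice
  -- the radius `5 * s * D` of the sets `A j`. The largest value required is at most `11 * s ^ 2 *
  -- D`, within the assumed diameter.
  have hex : ∀ j : Fin s, ∃ v, (chop G w D l).Reachable x v ∧
      11 * s * D * (j : ℕ) ≤ pathDist G w x v ∧
      pathDist G w x v ≤ 11 * s * D * (j : ℕ) + D / 4 := by
    intro j
    refine exists_reachable_value hlip (by linarith) hxy ?_ ?_
    · rw [pathDist_self hw]
      positivity
    · have : ((j : ℕ) : ℝ) ≤ s := by exact_mod_cast j.2.le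
      nlinarith
  choose a ha h1 h2 using hex
  have hlt : ∀ i j : Fin s, i < j → 10 * s * D < pathDist G w (a i) (a j) := by
    intro i j hij
    have h3 := pathDist_triangle hw (hG.preconnected x (a i)) (hG.preconnected (a i) (a j))
    have h4 : ((i : ℕ) : ℝ) + 1 ≤ (j : ℕ) := by exact_mod_cast hij
    have h5 : 11 * s * D * (((i : ℕ) : ℝ) + 1) ≤ 11 * s * D * (j : ℕ) :=
      mul_le_mul_of_nonneg_left h4 (by positivity)
    have h6 := h1 j
    have h7 := h2 i
    linarith
  have hsep : ∀ i j, i ≠ j → 10 * s * D < pathDist G w (a i) (a j) := by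
    intro i j hij
    rcases lt_or_gt_of_ne hij with h | h
    · exact hlt i j h
    · rw [pathDist_comm]
      exact hlt j i h
  obtain ⟨F⟩ := Fan.nonempty_of_chop hG hw hD (by nlinarith) l hxy
    ⟨Fan.base (G := G) hw D ha⟩
  rw [zero_add, hl] at F
  exact hfree (F.isGraphMinor hG hw hsep)

/-- Short balls are contained in a component for a suitable sequence of offsets. -/
theorem exists_chop_ball [Finite V] (hG : G.Connected) (hw : ∀ e ∈ G.edgeSet, 0 < w e) {D : ℝ}
    (hD : 0 < D) (x : V) (n : ℕ) :
    ∃ l : List (Fin 3), l.length = n ∧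
      ∀ y, pathDist G w x y < D / 4 → (chop G w D l).Reachable x y := by
  obtain ⟨l, hl, h⟩ := exists_chop_padded hw hD x n
  refine ⟨l, hl, fun y hy => ?_⟩
  have : Nonempty (G.Walk x y) := hG.preconnected x y
  obtain ⟨p, hp⟩ := exists_lt_of_ciInf_lt hy
  exact ⟨p.transfer _ (h y p hp.le)⟩

end Fan

/-! ### The tree of a nested sequence of partitions. -/

section HierarchyTree

variable {V : Type u}

/-- The vertices of the tree of a finite sequence of partitions: the cells at all levels. -/
abbrev HierarchyNode (Q : ℕ → Setoid V) (N : ℕ) : Type u :=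
  Σ n : Fin (N + 1), Quotient (Q n)

variable {Q : ℕ → Setoid V} {N : ℕ} {h : ℕ → ℝ}

/-- The cell of `x` at level `n`. -/
def hierarchyNode (Q : ℕ → Setoid V) {N : ℕ} (n : Fin (N + 1)) (x : V) : HierarchyNode Q N :=
  ⟨n, Quotient.mk (Q n) x⟩

theorem hierarchyNode_eq_iff {n m : Fin (N + 1)} {x y : V} :
    hierarchyNode Q n x = hierarchyNode Q m y ↔ n = m ∧ Q n x y := by
  constructor
  · intro e
    obtain rfl : n = m := congrArg Sigma.fst e
    simp only [hierarchyNode, Sigma.mk.injEq, heq_eq_eq, true_and] at e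
    exact ⟨rfl, Quotient.exact e⟩
  · rintro ⟨rfl, e⟩
    unfold hierarchyNode
    rw [Quotient.sound (s := Q n) e]

theorem exists_eq_hierarchyNode (u : HierarchyNode Q N) : ∃ n x, u = hierarchyNode Q n x := by
  obtain ⟨n, q⟩ := u
  obtain ⟨x, rfl⟩ := Quotient.exists_rep q
  exact ⟨n, x, rfl⟩

/-- The graph in which each cell is joined to the cell of the next level that contains it. -/
def hierarchyGraph (Q : ℕ → Setoid V) (N : ℕ) : SimpleGraph (HierarchyNode Q N) where
  Adj u v := ∃ (n : Fin N) (x : V),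
    (u = hierarchyNode Q n.castSucc x ∧ v = hierarchyNode Q n.succ x) ∨
    (v = hierarchyNode Q n.castSucc x ∧ u = hierarchyNode Q n.succ x)
  symm := ⟨fun _ _ ⟨n, x, e⟩ => ⟨n, x, e.symm⟩⟩
  loopless := ⟨by
    rintro u ⟨n, x, ⟨h1, h2⟩ | ⟨h1, h2⟩⟩ <;>
    · rw [h1, hierarchyNode_eq_iff] at h2
      exact Fin.castSucc_lt_succ.ne h2.1⟩

theorem hierarchyGraph_adj (n : Fin N) (x : V) :
    (hierarchyGraph Q N).Adj (hierarchyNode Q n.castSucc x) (hierarchyNode Q n.succ x) :=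
  ⟨n, x, Or.inl ⟨rfl, rfl⟩⟩

/-- The weight of an edge is the difference of the heights of its ends. -/
noncomputable def hierarchyWeight (Q : ℕ → Setoid V) (N : ℕ) (h : ℕ → ℝ) :
    Sym2 (HierarchyNode Q N) → ℝ :=
  Sym2.lift ⟨fun u v => |h u.1 - h v.1|, fun _ _ => abs_sub_comm _ _⟩

theorem hierarchyWeight_mk (u v : HierarchyNode Q N) :
    hierarchyWeight Q N h s(u, v) = |h u.1 - h v.1| := rfl

theorem hierarchyWeight_pos (hh : StrictMono h) :
    ∀ e ∈ (hierarchyGraph Q N).edgeSet, 0 < hierarchyWeight Q N h e := by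
  intro e he
  induction e with
  | h u v =>
    rw [hierarchyWeight_mk, abs_pos, sub_ne_zero]
    obtain ⟨n, x, ⟨rfl, rfl⟩ | ⟨rfl, rfl⟩⟩ := he
    · exact hh.injective.ne (Nat.lt_succ_self _).ne
    · exact hh.injective.ne (Nat.lt_succ_self _).ne'

theorem exists_walk_to_ancestor (hh : StrictMono h) (h0 : h 0 = 0) (x : V) (n : Fin (N + 1)) :
    ∃ p : (hierarchyGraph Q N).Walk (hierarchyNode Q 0 x) (hierarchyNode Q n x),
      walkLength (hierarchyWeight Q N h) p = h n := by
  induction n using Fin.induction with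
  | zero => exact ⟨SimpleGraph.Walk.nil, by simp [h0]⟩
  | succ n ih =>
    obtain ⟨p, hp⟩ := ih
    refine ⟨p.concat (hierarchyGraph_adj n x), ?_⟩
    rw [walkLength_concat, hp, hierarchyWeight_mk]
    have h1 : h n < h (n + 1) := hh (Nat.lt_succ_self _)
    simp only [hierarchyNode, Fin.val_castSucc, Fin.val_succ]
    rw [abs_of_neg (by linarith)]
    ring

/-- The cells contained in the cell of `x` at level `n`. -/
def IsBelow (n : Fin (N + 1)) (x : V) (u : HierarchyNode Q N) : Prop :=
  ∃ m y, u = hierarchyNode Q m y ∧ m ≤ n ∧ Q n y x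

theorem isBelow_hierarchyNode (hQ : Monotone Q) {n m : Fin (N + 1)} {x y : V} :
    IsBelow n x (hierarchyNode Q m y) ↔ m ≤ n ∧ Q n y x := by
  constructor
  · rintro ⟨m', y', e, h1, h2⟩
    obtain ⟨rfl, e'⟩ := hierarchyNode_eq_iff.1 e
    exact ⟨h1, (Q n).trans (hQ h1 e') h2⟩
  · exact fun e => ⟨m, y, rfl, e⟩

/-- Both ends of an edge are cells of the same `y`, so the condition `Q n y x` is common to them.
Only the level condition can change, and it does so exactly on the edges from level `n` to level `n
+ 1`. -/
theorem isBelow_edge (hQ : Monotone Q) {n m : Fin N} {x y : V} :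
    (IsBelow n.castSucc x (hierarchyNode Q m.castSucc y) ↔
      IsBelow n.castSucc x (hierarchyNode Q m.succ y)) ∨
    (m = n ∧ IsBelow n.castSucc x (hierarchyNode Q m.castSucc y) ∧
      ¬ IsBelow n.castSucc x (hierarchyNode Q m.succ y) ∧ Q n y x) := by
  simp only [isBelow_hierarchyNode hQ, Fin.castSucc_le_castSucc_iff, Fin.succ_le_castSucc_iff]
  rcases lt_trichotomy m n with hm | rfl | hm
  · simp [hm, hm.le]
  · by_cases hyx : Q m y x <;> simp [hyx]
  · simp [hm.not_ge, hm.not_gt]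

/-- All leaves reach the single top cell. Every edge is a bridge, because it is the only edge
leaving the set of cells below its lower end. -/
theorem hierarchyGraph_isTree [Nonempty V] (hQ : Monotone Q) (hN : Q N = ⊤) :
    (hierarchyGraph Q N).IsTree := by
  have hanc : ∀ n x, (hierarchyGraph Q N).Reachable (hierarchyNode Q 0 x)
      (hierarchyNode Q n x) := by
    intro n x
    induction n using Fin.induction with
    | zero => exact SimpleGraph.Reachable.refl _
    | succ n ih => exact ih.trans (hierarchyGraph_adj n x).reachable
  refine { connected := ?_, isAcyclic := ?_ }
  · have x₀ : V := Classical.arbitrary V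
    rw [SimpleGraph.connected_iff_exists_forall_reachable]
    refine ⟨hierarchyNode Q (Fin.last N) x₀, fun u => ?_⟩
    obtain ⟨n, x, rfl⟩ := exists_eq_hierarchyNode u
    have e : hierarchyNode Q (Fin.last N) x₀ = hierarchyNode Q (Fin.last N) x := by
      rw [hierarchyNode_eq_iff]
      refine ⟨rfl, ?_⟩
      rw [Fin.val_last, hN]
      trivial
    rw [e]
    exact (hanc _ x).symm.trans (hanc n x)
  · rw [SimpleGraph.isAcyclic_iff_forall_adj_isBridge]
    have key : ∀ (n : Fin N) (x : V), (hierarchyGraph Q N).IsBridge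
        s(hierarchyNode Q n.castSucc x, hierarchyNode Q n.succ x) := by
      intro n x
      rw [SimpleGraph.isBridge_iff]
      rintro ⟨p⟩
      have hstay : ∀ {a b} (p : ((hierarchyGraph Q N).deleteEdges
          {s(hierarchyNode Q n.castSucc x, hierarchyNode Q n.succ x)}).Walk a b),
          IsBelow n.castSucc x a → IsBelow n.castSucc x b := by
        intro a b p
        induction p with
        | nil => exact id
        | cons hab p ih =>
          intro ha
          refine ih ?_
          rw [SimpleGraph.deleteEdges_adj] at hab
          obtain ⟨⟨m, y, hmy⟩, hne⟩ := hab
          have hcross : ∀ m y, m = n → Q n y x →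
              s(hierarchyNode Q (N := N) m.castSucc y, hierarchyNode Q m.succ y) =
              s(hierarchyNode Q n.castSucc x, hierarchyNode Q n.succ x) := by
            rintro m y rfl hyx
            rw [(hierarchyNode_eq_iff (n := m.castSucc) (m := m.castSucc)).2 ⟨rfl, hyx⟩,
              (hierarchyNode_eq_iff (n := m.succ) (m := m.succ)).2
                ⟨rfl, hQ (Nat.le_succ _) hyx⟩]
          rcases hmy with ⟨rfl, rfl⟩ | ⟨rfl, rfl⟩
          · rcases isBelow_edge hQ (n := n) (m := m) (x := x) (y := y) with h1 | ⟨h1, -, -, h2⟩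
            · exact h1.1 ha
            · exact absurd (hcross m y h1 h2) hne
          · rcases isBelow_edge hQ (n := n) (m := m) (x := x) (y := y) with h1 | ⟨-, h1, -⟩
            · exact h1.2 ha
            · exact h1
      have h1 := hstay p ((isBelow_hierarchyNode hQ).2 ⟨le_rfl, (Q _).refl x⟩)
      rw [isBelow_hierarchyNode hQ] at h1
      exact absurd h1.1 (not_le_of_gt Fin.castSucc_lt_succ)
    rintro u v ⟨n, x, ⟨rfl, rfl⟩ | ⟨rfl, rfl⟩⟩
    · exact key n x
    · rw [Sym2.eq_swap]
      exact key n x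

/-- A walk between leaves that lie in different cells of level `n` visits level `n + 1`. -/
theorem le_walkLength_of_not_rel (hQ : Monotone Q) (h0 : h 0 = 0) (n : Fin N)
    {x y : V} (hxy : ¬ Q n x y)
    (p : (hierarchyGraph Q N).Walk (hierarchyNode Q 0 x) (hierarchyNode Q 0 y)) :
    2 * h (n + 1) ≤ walkLength (hierarchyWeight Q N h) p := by
  classical
  -- The potential is the height below the cell of `x`, and the height reflected at `h (n + 1)`
  -- elsewhere. It is 1-Lipschitz even on the edge where the two formulas meet, and rises from `0`
  -- at `x` to `2 * h (n + 1)` at `y`.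
  set φ : HierarchyNode Q N → ℝ := fun u =>
    if IsBelow n.castSucc x u then h u.1 else 2 * h (n + 1) - h u.1 with hφ
  have hedge : ∀ (m : Fin N) (z : V), |φ (hierarchyNode Q m.castSucc z) - φ (hierarchyNode Q m.succ z)| ≤
      hierarchyWeight Q N h s(hierarchyNode Q m.castSucc z, hierarchyNode Q m.succ z) := by
    intro m z
    rw [hierarchyWeight_mk]
    rcases isBelow_edge hQ (n := n) (m := m) (x := x) (y := z) with h1 | ⟨rfl, h1, h2, -⟩
    · by_cases h2 : IsBelow n.castSucc x (hierarchyNode Q m.castSucc z)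
      · simp only [hφ, if_pos h2, if_pos (h1.1 h2)]
        exact le_rfl
      · simp only [hφ, if_neg h2, if_neg fun h3 => h2 (h1.2 h3)]
        rw [sub_sub_sub_cancel_left, abs_sub_comm]
    · simp only [hφ, if_pos h1, if_neg h2]
      simp only [hierarchyNode, Fin.val_castSucc, Fin.val_succ]
      refine le_of_eq ?_
      congr 1
      ring
  have hlip : ∀ a b, (hierarchyGraph Q N).Adj a b → |φ a - φ b| ≤ hierarchyWeight Q N h s(a, b) := by
    rintro a b ⟨m, z, ⟨rfl, rfl⟩ | ⟨rfl, rfl⟩⟩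
    · exact hedge m z
    · rw [abs_sub_comm, Sym2.eq_swap]
      exact hedge m z
  have h1 := (abs_le.1 (abs_sub_le_walkLength hlip p)).1
  have hx : φ (hierarchyNode Q 0 x) = 0 := by
    simp only [hφ, if_pos ((isBelow_hierarchyNode hQ (n := n.castSucc) (m := 0) (x := x)
      (y := x)).2 ⟨Fin.zero_le _, (Q _).refl x⟩)]
    exact h0
  have hy : φ (hierarchyNode Q 0 y) = 2 * h (n + 1) := by
    have : ¬ IsBelow n.castSucc x (hierarchyNode Q (N := N) 0 y) := fun h2 =>
      hxy ((Q n).symm ((isBelow_hierarchyNode hQ).1 h2).2)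
    simp only [hφ, if_neg this]
    simp [hierarchyNode, h0]
  rw [hx, hy] at h1
  linarith

/-- A nested sequence of partitions yields a tree that induces an ultrametric. -/
theorem exists_ultrametric_tree [Finite V] [Nonempty V] (hQ : Monotone Q) (hbot : Q 0 = ⊥)
    (hN : Q N = ⊤) (hh : StrictMono h) (h0 : h 0 = 0) :
    ∃ T : WeightedTree V, T.IsUltrametric ∧
      (∀ n x y, Q n x y → T.treeDist x y ≤ 2 * h n) ∧
      (∀ n x y, ¬ Q n x y → 2 * h (n + 1) ≤ T.treeDist x y) := by
  have hpos := hierarchyWeight_pos (Q := Q) (N := N) hh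
  let T : WeightedTree V :=
    { Vert := HierarchyNode Q N
      finite_vert := inferInstance
      graph := hierarchyGraph Q N
      isTree := hierarchyGraph_isTree hQ hN
      weight := hierarchyWeight Q N h
      weight_pos := hpos
      point := ⟨hierarchyNode Q 0, fun x y e => by
        have := (hierarchyNode_eq_iff.1 e).2
        rw [Fin.val_zero, hbot] at this
        exact this⟩ }
  have hupper' : ∀ n : Fin (N + 1), ∀ x y, Q n x y → T.treeDist x y ≤ 2 * h n := by
    intro n x y hxy
    obtain ⟨p, hp⟩ := exists_walk_to_ancestor (Q := Q) hh h0 x n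
    have hy := exists_walk_to_ancestor (Q := Q) hh h0 y n
    rw [← hierarchyNode_eq_iff.2 ⟨rfl, hxy⟩] at hy
    obtain ⟨q, hq⟩ := hy
    have h1 := pathDist_le_walkLength hpos (p.append q.reverse)
    rw [walkLength_append, walkLength_reverse, hp, hq, ← two_mul] at h1
    exact h1
  have hlower : ∀ n x y, ¬ Q n x y → 2 * h (n + 1) ≤ T.treeDist x y := by
    intro n x y hxy
    have hn : n < N := by
      by_contra! hn
      have := hQ hn
      rw [hN] at this
      exact hxy (this trivial)
    have : Nonempty (T.graph.Walk (T.point x) (T.point y)) :=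
      T.isTree.connected.preconnected _ _
    exact le_ciInf fun p => le_walkLength_of_not_rel hQ h0 ⟨n, hn⟩ hxy p
  have hupper : ∀ n x y, Q n x y → T.treeDist x y ≤ 2 * h n := by
    intro n x y hxy
    rcases le_or_gt n N with hn | hn
    · exact hupper' ⟨n, Nat.lt_succ_of_le hn⟩ x y hxy
    · have h1 := hupper' (Fin.last N) x y (by rw [Fin.val_last, hN]; trivial)
      rw [Fin.val_last] at h1
      linarith [hh hn]
  refine ⟨T, @IsUltrametricDist.mk V ⟨T.treeDist⟩ fun x y z => ?_, hupper, hlower⟩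
  classical
  change T.treeDist x z ≤ max (T.treeDist x y) (T.treeDist y z)
  have hex : ∃ n, Q n x z := ⟨N, by rw [hN]; trivial⟩
  have h1 := hupper _ x z (Nat.find_spec hex)
  rcases Nat.eq_zero_or_pos (Nat.find hex) with e | e
  · rw [e, h0, mul_zero] at h1
    exact h1.trans (le_max_of_le_left (pathDist_nonneg T.weight_pos _ _))
  · obtain ⟨n, hn⟩ := Nat.exists_eq_succ_of_ne_zero e.ne'
    have h2 : ¬ Q n x z := Nat.find_min hex (hn ▸ Nat.lt_succ_self n)
    rw [hn] at h1
    refine h1.trans ?_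
    -- Level `n + 1` is the first to unite `x` and `z`, so at level `n` the point `y` is separated
    -- from at least one of them.
    by_cases h3 : Q n x y
    · exact le_max_of_le_right (hlower n y z fun h4 => h2 ((Q n).trans h3 h4))
    · exact le_max_of_le_left (hlower n x y h3)

end HierarchyTree

/-! ### From partitions at all scales to ultrametrics. -/

section Hierarchy

variable {V : Type u}

/-- Merge the cells of the previous partition according to the cells of `P n` that contain their
representatives. -/
noncomputable def hierarchy (P : ℕ → Setoid V) : ℕ → Setoid V
  | 0 => ⊥
  | n + 1 => (P n).comap fun x => (Quotient.mk (hierarchy P n) x).out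

theorem hierarchy_out (P : ℕ → Setoid V) (n : ℕ) (x : V) :
    hierarchy P n (Quotient.mk (hierarchy P n) x).out x :=
  Quotient.mk_out (s := hierarchy P n) x

theorem hierarchy_monotone (P : ℕ → Setoid V) : Monotone (hierarchy P) := by
  refine monotone_nat_of_le_succ fun n x y hxy => ?_
  change P n (Quotient.mk (hierarchy P n) x).out (Quotient.mk (hierarchy P n) y).out
  rw [Quotient.sound (s := hierarchy P n) hxy]

variable {d : V → V → ℝ}

/-- With `E = (4 * K) ^ n * δ`, going through the two representatives costs `2 * K * E` on each side
and `4 * K ^ 2 * E` between them. For `K ≥ 1` the sum is at most `8 * K ^ 2 * E`, the bound of the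
next level. -/
theorem hierarchy_diam {K δ : ℝ} (hK : 1 ≤ K) (hδ : 0 < δ) (hself : ∀ x, d x x = 0)
    (hcomm : ∀ x y, d x y = d y x) (htri : ∀ x y z, d x z ≤ d x y + d y z) {P : ℕ → Setoid V}
    (hP : ∀ n x y, P n x y → d x y ≤ K * ((4 * K) ^ (n + 1) * δ)) (n : ℕ) {x y : V}
    (hxy : hierarchy P n x y) : d x y ≤ 2 * K * ((4 * K) ^ n * δ) := by
  induction n generalizing x y with
  | zero =>
    obtain rfl : x = y := hxy
    rw [hself]
    positivity
  | succ n ih =>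
    have h1 := ih (hierarchy_out P n x)
    have h2 := ih (hierarchy_out P n y)
    have h3 := hP n _ _ hxy
    set x' := (Quotient.mk (hierarchy P n) x).out
    set y' := (Quotient.mk (hierarchy P n) y).out
    have h4 := htri x x' y
    have h5 := htri x' y' y
    rw [hcomm x x'] at h4
    rw [pow_succ] at h3 ⊢
    set E := (4 * K) ^ n * δ with hE
    have hE0 : 0 < E := by positivity
    have e : (4 * K) ^ n * (4 * K) * δ = 4 * K * E := by rw [hE]; ring
    rw [e] at h3 ⊢
    have h6 : K * E ≤ K * (K * E) := le_mul_of_one_le_left (by positivity) hK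
    nlinarith

/-- Families of partitions at all scales, with cells of diameter at most `K Δ`, such that each ball
of radius `Δ` is contained in a cell of one of the partitions, yield a cover by ultrametrics. -/
theorem exists_ultrametric_cover [Finite V] [Nonempty V] {ι : Type*} {K δ : ℝ} (hK : 1 ≤ K)
    (hδ : 0 < δ) (hself : ∀ x, d x x = 0) (hcomm : ∀ x y, d x y = d y x)
    (htri : ∀ x y z, d x z ≤ d x y + d y z) (hsep : ∀ x y, x ≠ y → δ ≤ d x y)
    (P : ι → ℝ → Setoid V) (hdiam : ∀ i D, 0 < D → ∀ x y, P i D x y → d x y ≤ K * D)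
    (hpad : ∀ D, 0 < D → ∀ x, ∃ i, ∀ y, d x y < D → P i D x y) :
    ∃ T : ι → WeightedTree V, (∀ i, (T i).IsUltrametric) ∧ (∀ i, (T i).Dominating d) ∧
      ∀ x y, x ≠ y → ∃ i, (T i).treeDist x y ≤ 16 * K ^ 2 * d x y := by
  classical
  have hK0 : 0 < K := by linarith
  have hΔ : ∀ n : ℕ, 0 < (4 * K) ^ n * δ := fun n => by positivity
  have hbig : ∀ c : ℝ, ∃ n : ℕ, c < (4 * K) ^ n * δ := fun c => by
    obtain ⟨n, hn⟩ := pow_unbounded_of_one_lt (c / δ) (show 1 < 4 * K by linarith)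
    exact ⟨n, (div_lt_iff₀ hδ).1 hn⟩
  -- Replacing a partition by `⊤` once its diameter bound holds for all pairs makes the hierarchy
  -- end in one cell, and keeps both the diameter bound and the padding.
  let P' : ι → ℕ → Setoid V := fun i n =>
    if ∀ x y, d x y ≤ K * ((4 * K) ^ (n + 1) * δ) then ⊤ else P i ((4 * K) ^ (n + 1) * δ)
  have hP' : ∀ i n x y, P' i n x y → d x y ≤ K * ((4 * K) ^ (n + 1) * δ) := by
    intro i n x y hxy
    by_cases hc : ∀ x y, d x y ≤ K * ((4 * K) ^ (n + 1) * δ)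
    · exact hc x y
    · have e : P' i n = P i ((4 * K) ^ (n + 1) * δ) := if_neg hc
      rw [e] at hxy
      exact hdiam i _ (hΔ _) x y hxy
  have hPP' : ∀ i n x y, P i ((4 * K) ^ (n + 1) * δ) x y → P' i n x y := by
    intro i n x y hxy
    by_cases hc : ∀ x y, d x y ≤ K * ((4 * K) ^ (n + 1) * δ)
    · have e : P' i n = ⊤ := if_pos hc
      rw [e]
      trivial
    · have e : P' i n = P i ((4 * K) ^ (n + 1) * δ) := if_neg hc
      rwa [e]
  obtain ⟨N, hN⟩ : ∃ N : ℕ, ∀ x y, d x y ≤ K * ((4 * K) ^ (N + 1) * δ) := by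
    obtain ⟨⟨x₀, y₀⟩, h₀⟩ := Finite.exists_max fun p : V × V => d p.1 p.2
    obtain ⟨n, hn⟩ := hbig (d x₀ y₀)
    refine ⟨n, fun x y => (h₀ (x, y)).trans (hn.le.trans ?_)⟩
    rw [pow_succ]
    have := hΔ n
    calc (4 * K) ^ n * δ ≤ (K * (4 * K)) * ((4 * K) ^ n * δ) :=
          le_mul_of_one_le_left this.le (by nlinarith)
      _ = K * ((4 * K) ^ n * (4 * K) * δ) := by ring
  have htop : ∀ i, hierarchy (P' i) (N + 1) = ⊤ := by
    intro i
    have e : P' i N = ⊤ := if_pos hN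
    rw [hierarchy, e]
    rfl
  -- At positive levels `2 * h n` equals the bound of `hierarchy_diam`, which gives domination.
  -- Leaves must have height `0`.
  let h : ℕ → ℝ := fun n => if n = 0 then 0 else K * ((4 * K) ^ n * δ)
  have h0 : h 0 = 0 := if_pos rfl
  have hs : ∀ n, h (n + 1) = K * ((4 * K) ^ (n + 1) * δ) := fun n => if_neg n.succ_ne_zero
  have hh : StrictMono h := by
    refine strictMono_nat_of_lt_succ fun n => ?_
    rw [hs]
    cases n with
    | zero => rw [h0]; exact mul_pos hK0 (hΔ _)
    | succ n =>
      rw [hs]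
      have h1 : (4 * K) ^ (n + 1) < (4 * K) ^ (n + 1 + 1) :=
        pow_lt_pow_right₀ (by linarith) (Nat.lt_succ_self _)
      gcongr
  choose T hT hupper hlower using fun i =>
    exists_ultrametric_tree (hierarchy_monotone (P' i)) rfl (htop i) hh h0
  refine ⟨T, hT, fun i x y => ?_, fun x y hxy => ?_⟩
  · by_cases hxy : x = y
    · rw [hxy, hself]
      exact pathDist_nonneg (T i).weight_pos _ _
    · have hex : ∃ n, hierarchy (P' i) n x y := ⟨N + 1, by rw [htop]; trivial⟩
      have h1 := Nat.find_spec hex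
      obtain ⟨n, hn⟩ : ∃ n, Nat.find hex = n + 1 := by
        refine Nat.exists_eq_succ_of_ne_zero fun e => hxy ?_
        rw [e] at h1
        exact h1
      have h2 := hlower i n x y (Nat.find_min hex (hn ▸ Nat.lt_succ_self n))
      rw [hn] at h1
      have h3 := hierarchy_diam hK hδ hself hcomm htri (hP' i) _ h1
      rw [hs] at h2
      linarith
  -- The critical level is the first whose diameter bound exceeds `d x y`. Minimality, or `hsep` at
  -- level `0`, makes its scale at most `2 * d x y`.
  · have hex : ∃ n : ℕ, d x y < 2 * K * ((4 * K) ^ n * δ) := by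
      obtain ⟨n, hn⟩ := hbig (d x y)
      exact ⟨n, hn.trans_le (le_mul_of_one_le_left (hΔ n).le (by linarith))⟩
    have hlt := Nat.find_spec hex
    have hle : (4 * K) ^ Nat.find hex * δ ≤ 2 * d x y := by
      rcases Nat.eq_zero_or_pos (Nat.find hex) with e | e
      · rw [e, pow_zero, one_mul]
        linarith [hsep x y hxy]
      · obtain ⟨n, hn⟩ := Nat.exists_eq_succ_of_ne_zero e.ne'
        have h1 := Nat.find_min hex (hn ▸ Nat.lt_succ_self n)
        rw [hn, Nat.succ_eq_add_one, pow_succ]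
        linarith
    set n := Nat.find hex
    obtain ⟨i, hi⟩ := hpad _ (hΔ (n + 1)) x
    have hΔs : (4 * K) ^ (n + 1) * δ = 4 * K * ((4 * K) ^ n * δ) := by ring
    have hrel : hierarchy (P' i) (n + 1) x y := by
      have hx := hierarchy_diam hK hδ hself hcomm htri (hP' i) n (hierarchy_out (P' i) n x)
      have hy := hierarchy_diam hK hδ hself hcomm htri (hP' i) n (hierarchy_out (P' i) n y)
      have hpos := mul_pos hK0 (hΔ n)
      rw [hcomm] at hx hy
      -- Both representatives lie within `4 * K * ((4 * K) ^ n * δ)` of `x`, which is exactly the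
      -- padding radius of the next scale.
      refine hPP' i n _ _ (Setoid.trans' _ (Setoid.symm' _ (hi _ ?_)) (hi _ ?_))
      · linarith
      · linarith [htri x y (Quotient.mk (hierarchy (P' i) n) y).out]
    refine ⟨i, (hupper i _ x y hrel).trans ?_⟩
    rw [hs, hΔs]
    have := mul_le_mul_of_nonneg_left hle (show 0 ≤ 8 * K ^ 2 by positivity)
    linarith

end Hierarchy

/-! ### The tree cover of a graph without `K_{s,s}` minor. -/

theorem mainTheorem9 :
    ∃ C : ℝ, 0 < C ∧
      ∀ (s : ℕ), 1 ≤ s →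
      ∀ (V : Type u) [Finite V] (G : SimpleGraph V) (w : Sym2 V → ℝ),
        G.Connected → (∀ e ∈ G.edgeSet, 0 < w e) → KssMinorFree s G →
        ∃ T : Fin (3 ^ s) → WeightedTree V,
          IsTreeCover (pathDist G w) (C * (s : ℝ) ^ 4) (3 ^ s) T ∧
          ∀ i, (T i).IsUltrametric := by
  classical
  -- Layers of width `4 * D` give padding `D` and diameter `80 * s ^ 2 * D`. Hence `K = 80 * s ^ 2`,
  -- and `16 * K ^ 2 = 102400 * s ^ 4`.
  refine ⟨102400, by norm_num, fun s hs V _ G w hG hw hfree => ?_⟩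
  have := hG.nonempty
  have hs' : (1 : ℝ) ≤ s := by exact_mod_cast hs
  have hs2 : (1 : ℝ) ≤ (s : ℝ) ^ 2 := one_le_pow₀ hs'
  have hs4 : (1 : ℝ) ≤ (s : ℝ) ^ 4 := one_le_pow₀ hs'
  obtain ⟨δ, hδ, hsep⟩ : ∃ δ : ℝ, 0 < δ ∧ ∀ x y, x ≠ y → δ ≤ pathDist G w x y := by
    -- The value `1` on the diagonal keeps the minimum positive, also when `V` has a single vertex.
    obtain ⟨⟨x₀, y₀⟩, h₀⟩ := Finite.exists_min fun p : V × V =>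
      if p.1 = p.2 then 1 else pathDist G w p.1 p.2
    refine ⟨_, ?_, fun x y hxy => (h₀ (x, y)).trans_eq (if_neg hxy)⟩
    dsimp only
    split_ifs with h
    · exact one_pos
    · exact pathDist_pos hw (hG.preconnected _ _) h
  obtain ⟨T, hT, hdom, hdist⟩ := exists_ultrametric_cover (ι := List.Vector (Fin 3) s)
    (K := 80 * (s : ℝ) ^ 2) (by linarith) hδ (pathDist_self hw) pathDist_comm
    (fun x y z => pathDist_triangle hw (hG.preconnected x y) (hG.preconnected y z)) hsep
    (fun i D => (chop G w (4 * D) i.1).reachableSetoid)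
    (fun i D hD x y hxy => by
      have := pathDist_le_of_chop_reachable hG hw (D := 4 * D) (by linarith) hs hfree i.2 hxy
      linarith)
    (fun D hD x => by
      obtain ⟨l, hl, h⟩ := exists_chop_ball hG hw (D := 4 * D) (by linarith) x s
      exact ⟨⟨l, hl⟩, fun y hy => h y (by linarith)⟩)
  let e : Fin (3 ^ s) ≃ List.Vector (Fin 3) s :=
    (Fintype.equivFinOfCardEq (by rw [card_vector, Fintype.card_fin])).symm
  refine ⟨fun i => T (e i), ⟨by linarith, fun i => hdom (e i), fun x y hxy => ?_⟩,
    fun i => hT (e i)⟩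
  obtain ⟨i, hi⟩ := hdist x y hxy
  refine ⟨e.symm i, ?_⟩
  simp only [e.apply_symm_apply]
  refine hi.trans_eq ?_
  ring
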